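/- Let $(X,|\cdot|)$ be a Banach space, $F:X\to X$ a bounded linear operator and $\xi,f_0\in X$. Let $\Phi:(0,\infty)\to(0,\infty)$ be a special Bernstein function, i.e. $\Phi$ and $\lambda\mapsto\lambda/\Phi(\lambda)$ are both Bernstein functions ($C^\infty$, nonnegative, and with $(-1)^n$ times the $n$-th derivative $\le 0$ on $(0,\infty)$ for every $n\ge 1$). Suppose that $$\Phi(\lambda)=\int_{(0,\infty)}(1-e^{-\lambda x})\,\nu_\Phi(dx)\quad(\lambda>0),$$ where the Lévy measure $\nu_\Phi$ on $(0,\infty)$ satisfies $\int_{(0,\infty)}\min(1,x)\,\nu_\Phi(dx)<\infty$ and $\nu_\Phi(0,\infty)=\infty$ and is absolutely continuous with respect to Lebesgue measure. Let $\sigma_\Phi$ be the subordinator (non-decreasing Lévy process) with $\mathbb E[e^{-\lambda\sigma_\Phi(t)}]=e^{-t\Phi(\lambda)}$ for $t\ge 0$, $\lambda>0$, and let $u_\Phi$ be its potential density, i.e. the nonnegative non-increasing function on $(0,\infty)$ with $\mathbb E\big[\int_0^\infty \mathbf 1_A(\sigma_\Phi(s))\,ds\big]=\int_A u_\Phi(t)\,dt$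 for all Borel sets $A\subseteq[0,\infty)$. Suppose that there are $t_0>0$, $C>0$ and $\beta\in(0,1)$ with $u_\Phi(t)\le C t^{\beta-1}$ for all $t\in(0,t_0)$. Put $\bar\nu_\Phi(t)=\nu_\Phi(t,\infty)$. Call a continuous function $f:[0,\infty)\to X$ a global solution of $$\partial_t^\Phi f(t)=\xi+Ff(t),\qquad f(0)=f_0,$$ if $f(0)=f_0$, the function $t\mapsto\int_0^t\bar\nu_\Phi(t-s)\,(f(s)-f(0))\,ds$ is locally absolutely continuous on $[0,\infty)$, and its derivative, which is $\partial_t^\Phi f(t)$, exists and equals $\xi+Ff(t)$ for almost every $t>0$. (In particular, continuous functions satisfying $f(0)=f_0$ and the equation at every $t\ge 0$ are global solutions.) Then there is at most one global solution: if $f_1,f_2\in C([0,\infty),X)$ are global solutions, then $f_1(t)=f_2(t)$ for all $t\ge 0$. -/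

import Mathlib

open MeasureTheory ProbabilityTheory Set
open scoped NNReal ENNReal

/-- Bernstein functions: smooth, nonnegative functions on `(0, ∞)` with
`(-1) ^ n Φ⁽ⁿ⁾ ≤ 0` for all `n ≥ 1`. Only the values on `(0, ∞)` matter. -/
structure IsBernstein (Φ : ℝ → ℝ) : Prop where
  smooth : ContDiffOn ℝ ((⊤ : ℕ∞) : WithTop ℕ∞) Φ (Ioi 0)
  nonneg : ∀ l : ℝ, 0 < l → 0 ≤ Φ l
  deriv_sign : ∀ n : ℕ, 1 ≤ n → ∀ l : ℝ, 0 < l → (-1 : ℝ) ^ n * iteratedDeriv n Φ l ≤ 0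

/-- Special Bernstein functions: Bernstein functions, not identically zero (for a Bernstein
function this is the same as being positive on `(0, ∞)`), whose conjugate
`l ↦ l / Φ l` is again a Bernstein function. -/
structure IsSpecialBernstein (Φ : ℝ → ℝ) : Prop where
  bernstein : IsBernstein Φ
  pos : ∀ l : ℝ, 0 < l → 0 < Φ l
  conjugate : IsBernstein (fun l => l / Φ l)

/-- `(a, b, ν)` is the Lévy triple of `Φ`: `a, b ≥ 0`, `ν` is a measure carried by `(0, ∞)` with
`∫ min(1, x) ν(dx) < ∞`, and `Φ l = a + b l + ∫ (1 - e^{-l x}) ν(dx)` for all `l > 0`. -/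
structure IsLevyTriple (Φ : ℝ → ℝ) (a b : ℝ) (ν : Measure ℝ) : Prop where
  killing_nonneg : 0 ≤ a
  drift_nonneg : 0 ≤ b
  carrier : ν (Iic 0) = 0
  integrable : ∫⁻ x in Ioi (0 : ℝ), ENNReal.ofReal (min 1 x) ∂ν < ∞
  repr : ∀ l : ℝ, 0 < l → Φ l = a + b * l + ∫ x in Ioi (0 : ℝ), (1 - Real.exp (-(l * x))) ∂ν

/-- The tail `ν̄(t) = ν(t, ∞)` of a Lévy measure (finite for `t > 0`; its value at `t = 0` is
irrelevant below, as it enters integrals at one point only). -/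
noncomputable def levyTail (ν : Measure ℝ) (t : ℝ) : ℝ := ν.real (Ioi t)

/-- A subordinator: a real-valued Lévy process (started at `0`, with independent and stationary
increments and right-continuous paths) with non-decreasing paths. -/
structure IsSubordinator {Ω : Type*} [MeasurableSpace Ω] (σ : ℝ≥0 → Ω → ℝ) (P : Measure Ω) :
    Prop where
  measurable : ∀ t, Measurable (σ t)
  zero : ∀ᵐ ω ∂P, σ 0 ω = 0
  indep : HasIndepIncrements σ P
  stationary : ∀ t h : ℝ≥0, IdentDistrib (fun ω => σ (t + h) ω - σ t ω) (σ h) P P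
  mono : ∀ᵐ ω ∂P, Monotone (fun t => σ t ω)
  right_cont : ∀ᵐ ω ∂P, ∀ t, ContinuousWithinAt (fun s => σ s ω) (Ici t) t

/-- `Φ` is the Laplace exponent of `σ`: `E[e^{-l σ(t)}] = e^{-t Φ(l)}`. -/
def HasLaplaceExponent {Ω : Type*} [MeasurableSpace Ω] (σ : ℝ≥0 → Ω → ℝ) (P : Measure Ω)
    (Φ : ℝ → ℝ) : Prop :=
  ∀ t : ℝ≥0, ∀ l : ℝ, 0 < l →
    ∫ ω, Real.exp (-(l * σ t ω)) ∂P = Real.exp (-((t : ℝ) * Φ l))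

/-- The potential measure `U(A) = E[∫₀^∞ 1_A(σ(s)) ds]` of the process `σ`, as a set function. -/
noncomputable def potential {Ω : Type*} [MeasurableSpace Ω] (σ : ℝ≥0 → Ω → ℝ) (P : Measure Ω)
    (A : Set ℝ) : ℝ≥0∞ :=
  ∫⁻ ω, (∫⁻ s in Ici (0 : ℝ), A.indicator 1 (σ s.toNNReal ω)) ∂P

/-- `u` is the potential density of `σ`: a nonnegative, non-increasing function on `(0, ∞)` with
`U(A) = ∫_A u(t) dt` for all Borel sets `A ⊆ [0, ∞)`. -/
structure IsPotentialDensity {Ω : Type*} [MeasurableSpace Ω] (σ : ℝ≥0 → Ω → ℝ) (P : Measure Ω)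
    (u : ℝ → ℝ) : Prop where
  nonneg : ∀ t : ℝ, 0 < t → 0 ≤ u t
  antitone : AntitoneOn u (Ioi 0)
  density : ∀ A : Set ℝ, MeasurableSet A → A ⊆ Ici 0 →
    potential σ P A = ∫⁻ t in A ∩ Ioi 0, ENNReal.ofReal (u t)

section Caputo

variable {X : Type*} [NormedAddCommGroup X] [NormedSpace ℝ X]

/-- The convolution `∫₀ᵗ ν̄(t - s) (f(s) - f(0)) ds`. -/
noncomputable def tailConv (ν : Measure ℝ) (f : ℝ → X) (t : ℝ) : X :=
  ∫ s in (0 : ℝ)..t, levyTail ν (t - s) • (f s - f 0)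

/-- `f` has a generalized Caputo derivative on `[0, ∞)` and it equals `g`:
`t ↦ ∫₀ᵗ ν̄(t - s) (f(s) - f(0)) ds` is locally absolutely continuous on `[0, ∞)`, and its
derivative exists and equals `g(t)` for almost every `t > 0`. -/
structure HasCaputoDeriv (ν : Measure ℝ) (f g : ℝ → X) : Prop where
  absCont : ∀ T : ℝ, 0 < T → AbsolutelyContinuousOnInterval (tailConv ν f) 0 T
  deriv_eq : ∀ᵐ t : ℝ, 0 < t → HasDerivAt (tailConv ν f) (g t) t

/-- If the derivative of the convolution exists everywhere on `[0, ∞)` and is the continuous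
function `g`, then `g` is the generalized Caputo derivative of `f`; so an equation for the
Caputo derivative that holds at every point is covered by `HasCaputoDeriv`. -/
theorem HasCaputoDeriv.of_forall {ν : Measure ℝ} {f g : ℝ → X} (hg : ContinuousOn g (Ici 0))
    (h : ∀ t : ℝ, 0 ≤ t → HasDerivWithinAt (tailConv ν f) (g t) (Ici 0) t) :
    HasCaputoDeriv ν f g where
  absCont T hT := by
    have hsub : Icc (0 : ℝ) T ⊆ Ici 0 := fun x hx => hx.1
    obtain ⟨C, hC⟩ := isCompact_Icc.exists_bound_of_continuousOn (hg.mono hsub)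
    have hL : LipschitzOnWith C.toNNReal (tailConv ν f) (Icc 0 T) := by
      refine (convex_Icc 0 T).lipschitzOnWith_of_nnnorm_hasDerivWithin_le
        (fun x hx => (h x hx.1).mono hsub) (fun x hx => ?_)
      rw [← NNReal.coe_le_coe, coe_nnnorm]
      exact (hC x hx).trans (Real.le_coe_toNNReal C)
    rw [← uIcc_of_le hT.le] at hL
    exact hL.absolutelyContinuousOnInterval
  deriv_eq := Filter.Eventually.of_forall fun t ht => (h t ht.le).hasDerivAt (Ici_mem_nhds ht)

/-- `f` is a continuous solution on `[0, ∞)` of `∂^Φ f = ξ + F f`, `f(0) = f₀`, where `ν` is the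
Lévy measure of `Φ`. -/
structure IsGlobalSolution (ν : Measure ℝ) (F : X →L[ℝ] X) (ξ f₀ : X) (f : ℝ → X) : Prop where
  cont : ContinuousOn f (Ici 0)
  equation : HasCaputoDeriv ν f (fun t => ξ + F (f t))
  init : f 0 = f₀

end Caputo

/-! Let `w` be the difference of two solutions and `W` its primitive. The constant `ξ` and the
initial value cancel, so integrating the equation gives `ν̄ * w = F W`. The potential density
inverts the tail: `u` has Laplace transform `1 / Φ(l)` and `ν̄` has `Φ(l) / l`, so `u * ν̄` has
transform `1 / l` and is Lebesgue measure on `(0, ∞)`. Convolving with `u` yields the Volterra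
equation `W = u * F W`. Since `u(t) dt` has no mass on `(-∞, 0]`, its Laplace transform tends to `0`
at infinity. For large `l` the map `W ↦ u * F W` is therefore a strict contraction in the weighted
norm `sup e^{-l s} ‖W s‖` on a bounded interval, which forces `W = 0` and then `w = W' = 0`. The
lemmas that carry this are `IsPotentialDensity.conv_levyTail`, `integral_integral_of_conv_eq` and
`eq_zero_of_norm_le_conv`. -/

/-! ### Uniqueness for Laplace transforms. -/

/-- Measures on `ℝ` are determined by their Laplace transforms, if these are
finite on `(0, ∞)`. -/
theorem Measure.ext_of_laplace_eq {μ ν : Measure ℝ}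
    (hfin : ∀ l : ℝ, 0 < l → ∫⁻ x, ENNReal.ofReal (Real.exp (-(l * x))) ∂μ ≠ ∞)
    (h : ∀ l : ℝ, 0 < l → ∫⁻ x, ENNReal.ofReal (Real.exp (-(l * x))) ∂μ =
      ∫⁻ x, ENNReal.ofReal (Real.exp (-(l * x))) ∂ν) : μ = ν := by
  -- The tilt by `e^{-x}` makes both measures finite and shifts the half-plane of convergence to `Re
  -- z < 1`, which contains the imaginary axis.
  set e : ℝ → ℝ≥0∞ := fun x => ENNReal.ofReal (Real.exp (-x)) with he
  have hem : Measurable e := by fun_prop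
  have hmul (l x : ℝ) : e x * ENNReal.ofReal (Real.exp (l * x)) =
      ENNReal.ofReal (Real.exp (-((1 - l) * x))) := by
    rw [he, ← ENNReal.ofReal_mul (Real.exp_nonneg _), ← Real.exp_add]
    congr 2; ring
  have hwd (ρ : Measure ℝ) (l : ℝ) :
      ∫⁻ x, ENNReal.ofReal (Real.exp (l * x)) ∂(ρ.withDensity e) =
        ∫⁻ x, ENNReal.ofReal (Real.exp (-((1 - l) * x))) ∂ρ := by
    rw [lintegral_withDensity_eq_lintegral_mul _ hem (by fun_prop)]
    exact lintegral_congr fun x => hmul l x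
  have hint (ρ : Measure ℝ)
      (hρ : ∀ l : ℝ, 0 < l → ∫⁻ x, ENNReal.ofReal (Real.exp (-(l * x))) ∂ρ ≠ ∞) (l : ℝ)
      (hl : l < 1) : Integrable (fun x => Real.exp (l * id x)) (ρ.withDensity e) := by
    refine ⟨by fun_prop, ?_⟩
    rw [hasFiniteIntegral_iff_ofReal (Filter.Eventually.of_forall fun x => Real.exp_nonneg _)]
    simp only [id]
    rw [hwd]
    exact (hρ _ (by linarith)).lt_top
  have hfin' : ∀ l : ℝ, 0 < l → ∫⁻ x, ENNReal.ofReal (Real.exp (-(l * x))) ∂ν ≠ ∞ :=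
    fun l hl => h l hl ▸ hfin l hl
  have hfm (ρ : Measure ℝ)
      (hρ : ∀ l : ℝ, 0 < l → ∫⁻ x, ENNReal.ofReal (Real.exp (-(l * x))) ∂ρ ≠ ∞) :
      IsFiniteMeasure (ρ.withDensity e) :=
    isFiniteMeasure_withDensity (by simpa [he] using hρ 1 one_pos)
  have := hfm μ hfin
  have := hfm ν hfin'
  have hsub (ρ : Measure ℝ)
      (hρ : ∀ l : ℝ, 0 < l → ∫⁻ x, ENNReal.ofReal (Real.exp (-(l * x))) ∂ρ ≠ ∞) :
      {z : ℂ | z.re < 1} ⊆ {z | z.re ∈ interior (integrableExpSet id (ρ.withDensity e))} :=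
    fun z hz => interior_maximal (fun l hl => hint ρ hρ l hl) isOpen_Iio hz
  have hmgf (l : ℝ) (hl : l < 1) :
      mgf id (μ.withDensity e) l = mgf id (ν.withDensity e) l := by
    simp only [mgf]
    rw [integral_eq_lintegral_of_nonneg_ae (Filter.Eventually.of_forall fun x => Real.exp_nonneg _)
      (by fun_prop), integral_eq_lintegral_of_nonneg_ae
      (Filter.Eventually.of_forall fun x => Real.exp_nonneg _) (by fun_prop)]
    simp only [id]
    rw [hwd, hwd, h _ (by linarith)]
  -- Identity theorem: agreement on the reals near `0` spreads to the half-plane, and its imaginary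
  -- axis carries the characteristic functions.
  have heq : EqOn (complexMGF id (μ.withDensity e)) (complexMGF id (ν.withDensity e))
      {z : ℂ | z.re < 1} := by
    refine AnalyticOnNhd.eqOn_of_preconnected_of_frequently_eq
      (analyticOnNhd_complexMGF.mono (hsub μ hfin)) (analyticOnNhd_complexMGF.mono (hsub ν hfin'))
      (convex_halfSpace_re_lt 1).isPreconnected (z₀ := ((0 : ℝ) : ℂ)) (by simp) ?_
    have h_real : ∃ᶠ x : ℝ in nhdsWithin 0 {0}ᶜ, complexMGF id (μ.withDensity e) x =
        complexMGF id (ν.withDensity e) x := by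
      refine Filter.Eventually.frequently ?_
      filter_upwards [nhdsWithin_le_nhds (Iio_mem_nhds (zero_lt_one (α := ℝ)))] with x hx
      rw [complexMGF_ofReal, complexMGF_ofReal, hmgf x hx]
    refine Filter.Tendsto.frequently ?_ h_real
    refine tendsto_nhdsWithin_iff.2 ⟨?_, ?_⟩
    · exact (Complex.continuous_ofReal.tendsto 0).mono_left nhdsWithin_le_nhds
    · filter_upwards [self_mem_nhdsWithin] with x hx
      simpa using hx
  have hwμ : μ.withDensity e = ν.withDensity e := by
    refine Measure.ext_of_charFun (funext fun t => ?_)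
    rw [← complexMGF_id_mul_I, ← complexMGF_id_mul_I]
    exact heq (by simp)
  have hinv (ρ : Measure ℝ) : (ρ.withDensity e).withDensity (fun x => (e x)⁻¹) = ρ :=
    withDensity_inv_same hem (Filter.Eventually.of_forall fun x => by simp [he, Real.exp_pos])
      (Filter.Eventually.of_forall fun x => by simp [he])
  rw [← hinv μ, hwμ, hinv]

/-! ### Densities on the half-line. -/

/-- The measure on `(0, ∞)` with density `k`. -/
noncomputable def halfLineMeasure (k : ℝ → ℝ) : Measure ℝ :=
  (volume.restrict (Ioi 0)).withDensity fun t => ENNReal.ofReal (k t)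

theorem halfLineMeasure_Iic (k : ℝ → ℝ) : halfLineMeasure k (Iic 0) = 0 := by
  refine withDensity_absolutelyContinuous _ _ ?_
  rw [Measure.restrict_apply measurableSet_Iic, Iic_inter_Ioi, Ioc_self, measure_empty]

theorem lintegral_halfLineMeasure {k : ℝ → ℝ} (hk : AntitoneOn k (Ioi 0)) {g : ℝ → ℝ≥0∞}
    (hg : Measurable g) :
    ∫⁻ x, g x ∂(halfLineMeasure k) = ∫⁻ t in Ioi 0, ENNReal.ofReal (k t) * g t :=
  lintegral_withDensity_eq_lintegral_mul₀
    (aemeasurable_restrict_of_antitoneOn measurableSet_Ioi hk).ennreal_ofReal hg.aemeasurable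

theorem integral_halfLineMeasure {E : Type*} [NormedAddCommGroup E] [NormedSpace ℝ E] {k : ℝ → ℝ}
    (hk : AntitoneOn k (Ioi 0)) (hk0 : ∀ t, 0 < t → 0 ≤ k t) (g : ℝ → E) :
    ∫ x, g x ∂(halfLineMeasure k) = ∫ t in Ioi 0, k t • g t := by
  rw [halfLineMeasure, integral_withDensity_eq_integral_toReal_smul₀
    (aemeasurable_restrict_of_antitoneOn measurableSet_Ioi hk).ennreal_ofReal
    (Filter.Eventually.of_forall fun x => ENNReal.ofReal_lt_top)]
  refine setIntegral_congr_fun measurableSet_Ioi fun t ht => ?_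
  simp [ENNReal.toReal_ofReal (hk0 t ht)]

instance (k : ℝ → ℝ) : SFinite (halfLineMeasure k) := by
  unfold halfLineMeasure; infer_instance

theorem lintegral_exp_neg_mul_Ioi {c : ℝ} (hc : 0 < c) :
    ∫⁻ s in Ioi (0 : ℝ), ENNReal.ofReal (Real.exp (-(c * s))) = ENNReal.ofReal (1 / c) := by
  have hI := integrableOn_exp_mul_Ioi (neg_lt_zero.2 hc) 0
  have hv := integral_exp_mul_Ioi (neg_lt_zero.2 hc) 0
  simp only [neg_mul] at hI hv
  rw [← ofReal_integral_eq_lintegral_ofReal hI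
    (Filter.Eventually.of_forall fun _ => Real.exp_nonneg _), hv]
  simp

/-! ### The tail of the Lévy measure. -/

namespace IsLevyTriple

variable {Φ : ℝ → ℝ} {a b : ℝ} {ν : Measure ℝ}

/-- Markov's inequality: `min 1 x ≥ min 1 t` on `(t, ∞)`. -/
theorem measure_Ioi_lt_top (hν : IsLevyTriple Φ a b ν) {t : ℝ} (ht : 0 < t) : ν (Ioi t) < ∞ := by
  have hm : 0 < min 1 t := lt_min one_pos ht
  have h : ENNReal.ofReal (min 1 t) * ν (Ioi t) ≤
      ∫⁻ x in Ioi (0 : ℝ), ENNReal.ofReal (min 1 x) ∂ν := by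
    rw [← setLIntegral_const]
    refine (setLIntegral_mono' measurableSet_Ioi fun x hx => ?_).trans
      (lintegral_mono_set (Ioi_subset_Ioi ht.le))
    exact ENNReal.ofReal_le_ofReal (min_le_min_left _ (mem_Ioi.1 hx).le)
  by_contra hcon
  rw [not_lt, top_le_iff] at hcon
  rw [hcon, ENNReal.mul_top (ENNReal.ofReal_pos.2 hm).ne'] at h
  exact absurd hν.integrable (not_lt.2 h)

theorem antitoneOn_levyTail (hν : IsLevyTriple Φ a b ν) : AntitoneOn (levyTail ν) (Ioi 0) :=
  fun _ hs _ _ hst => measureReal_mono (Ioi_subset_Ioi hst) (hν.measure_Ioi_lt_top hs).ne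

/-- The Laplace transform of the tail of the Lévy measure is `Φ(l) / l`. -/
theorem lintegral_levyTail (hν : IsLevyTriple Φ 0 0 ν) {l : ℝ} (hl : 0 < l) (hΦ : 0 < Φ l) :
    ∫⁻ x, ENNReal.ofReal (Real.exp (-(l * x))) ∂(halfLineMeasure (levyTail ν)) =
      ENNReal.ofReal (Φ l / l) := by
  rw [lintegral_halfLineMeasure hν.antitoneOn_levyTail (by fun_prop)]
  have hprim (x : ℝ) : ∫ t in (0 : ℝ)..x, Real.exp (-(l * t)) = (1 - Real.exp (-(l * x))) / l := by
    have hd (t : ℝ) : HasDerivAt (fun t => -Real.exp (-(l * t)) / l) (Real.exp (-(l * t))) t := by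
      have := (((hasDerivAt_id t).const_mul l).neg.exp.neg).div_const l
      refine this.congr_deriv ?_
      simp only [id]
      field_simp
      rfl
    rw [intervalIntegral.integral_eq_sub_of_hasDerivAt (fun t _ => hd t)
      (Continuous.intervalIntegrable (by fun_prop) _ _)]
    simp; ring
  -- Layer-cake formula: integrating `e^{-l t}` against the tail equals integrating its primitive
  -- against `ν`.
  have hlc := lintegral_comp_eq_lintegral_meas_lt_mul (ν.restrict (Ioi 0)) (f := id)
    (g := fun t => Real.exp (-(l * t)))
    ((ae_restrict_mem measurableSet_Ioi).mono fun x hx => (mem_Ioi.1 hx).le) aemeasurable_id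
    (fun t _ => Continuous.intervalIntegrable (by fun_prop) _ _)
    (Filter.Eventually.of_forall fun t => Real.exp_nonneg _)
  have hR : ∫⁻ t in Ioi (0 : ℝ), ENNReal.ofReal (levyTail ν t) * ENNReal.ofReal (Real.exp (-(l * t)))
      = ∫⁻ t in Ioi (0 : ℝ), (ν.restrict (Ioi 0)) {x | t < id x} *
          ENNReal.ofReal (Real.exp (-(l * t))) := by
    refine setLIntegral_congr_fun measurableSet_Ioi fun t ht => ?_
    have hset : {x : ℝ | t < id x} = Ioi t := rfl
    simp only [hset]
    rw [Measure.restrict_apply measurableSet_Ioi,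
      inter_eq_left.2 (Ioi_subset_Ioi (mem_Ioi.1 ht).le), levyTail, Measure.real,
      ENNReal.ofReal_toReal (hν.measure_Ioi_lt_top ht).ne]
  rw [hR, ← hlc]
  simp only [id, hprim]
  have hrep : Φ l = ∫ x in Ioi (0 : ℝ), (1 - Real.exp (-(l * x))) ∂ν := by
    simpa using hν.repr l hl
  -- A non-integrable function has Bochner integral `0`, which would contradict `0 < Φ l`.
  have hI : Integrable (fun x => 1 - Real.exp (-(l * x))) (ν.restrict (Ioi 0)) := by
    by_contra hcon
    rw [hrep, integral_undef hcon] at hΦ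
    exact hΦ.false
  rw [← ofReal_integral_eq_lintegral_ofReal (hI.div_const l), integral_div, ← hrep]
  filter_upwards [ae_restrict_mem measurableSet_Ioi] with x hx
  have : Real.exp (-(l * x)) ≤ 1 := Real.exp_le_one_iff.2 (by
    have := mul_pos hl (mem_Ioi.1 hx); linarith)
  exact div_nonneg (by linarith) hl.le

end IsLevyTriple

/-! ### The potential measure and the Sonine relation. -/

open Filter Topology in
/-- A process with measurable marginals and right-continuous paths is jointly measurable. -/
theorem measurable_uncurry_of_rightCts {Ω : Type*} [MeasurableSpace Ω] {Y : ℝ≥0 → Ω → ℝ}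
    (hY : ∀ t, Measurable (Y t))
    (hc : ∀ ω t, ContinuousWithinAt (fun s => Y s ω) (Ici t) t) :
    Measurable fun p : Ω × ℝ≥0 => Y p.2 p.1 := by
  -- Grid points with `s < d n s ≤ s + 1 / (n + 1)`: right-continuity applies as they approach `s`,
  -- and for each `n` only countably many values occur.
  set d : ℕ → ℝ≥0 → ℝ≥0 := fun n s => ((⌊((n : ℝ≥0) + 1) * s⌋₊ : ℝ≥0) + 1) / ((n : ℝ≥0) + 1)
  have hpos (n : ℕ) : (0 : ℝ≥0) < (n : ℝ≥0) + 1 := by positivity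
  refine measurable_of_tendsto_metrizable (f := fun n p => Y (d n p.2) p.1) (fun n => ?_)
    (tendsto_pi_nhds.2 fun p => ?_)
  · have h : Measurable fun q : Ω × ℕ => Y (((q.2 : ℝ≥0) + 1) / ((n : ℝ≥0) + 1)) q.1 :=
      measurable_from_prod_countable_left fun k =>
        hY (((k : ℝ≥0) + 1) / ((n : ℝ≥0) + 1))
    have hk : Measurable fun p : Ω × ℝ≥0 => (p.1, ⌊((n : ℝ≥0) + 1) * p.2⌋₊) :=
      measurable_fst.prodMk (Nat.measurable_floor.comp (measurable_snd.const_mul _))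
    have := h.comp hk
    simpa only [d, Function.comp_def] using this
  · have hge (n : ℕ) : p.2 ≤ d n p.2 := by
      rw [le_div_iff₀ (hpos n), mul_comm]
      exact (Nat.lt_floor_add_one _).le
    have hle (n : ℕ) : d n p.2 ≤ p.2 + 1 / ((n : ℝ≥0) + 1) := by
      rw [div_le_iff₀ (hpos n), add_mul p.2, div_mul_cancel₀ _ (hpos n).ne', mul_comm p.2]
      gcongr
      exact Nat.floor_le (by positivity)
    have hlim : Tendsto (fun n : ℕ => p.2 + 1 / ((n : ℝ≥0) + 1)) atTop (𝓝 p.2) := by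
      simpa using tendsto_const_nhds.add (tendsto_one_div_add_atTop_nhds_zero_nat (𝕜 := ℝ≥0))
    exact (hc p.1 p.2).tendsto.comp (tendsto_nhdsWithin_iff.2
      ⟨tendsto_of_tendsto_of_tendsto_of_le_of_le tendsto_const_nhds hlim hge hle,
        Eventually.of_forall hge⟩)

section Potential

variable {Ω : Type*} [MeasurableSpace Ω] {P : Measure Ω} {σ : ℝ≥0 → Ω → ℝ} {u Φ : ℝ → ℝ}

/-- A subordinator has a version all of whose paths are nonnegative and which is jointly
measurable. -/
theorem IsSubordinator.exists_version (hσ : IsSubordinator σ P) :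
    ∃ Y : ℝ≥0 → Ω → ℝ, (Measurable fun p : Ω × ℝ≥0 => Y p.2 p.1) ∧ (∀ t ω, 0 ≤ Y t ω) ∧
      ∀ᵐ ω ∂P, ∀ t, σ t ω = Y t ω := by
  classical
  have hgood : ∀ᵐ ω ∂P, (∀ t, 0 ≤ σ t ω) ∧
      ∀ t, ContinuousWithinAt (fun s => σ s ω) (Ici t) t := by
    filter_upwards [hσ.zero, hσ.mono, hσ.right_cont] with ω h0 hm hc
    exact ⟨fun t => h0 ▸ hm zero_le, hc⟩
  -- The exceptional set need not be measurable; the paths are set to `0` on a measurable null set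
  -- containing it.
  obtain ⟨N, hsub, hNm, hN0⟩ := exists_measurable_superset_of_null (ae_iff.1 hgood)
  have hmem (ω : Ω) (hω : ω ∉ N) := not_not.1 (mt (@hsub ω) hω)
  refine ⟨fun t => N.piecewise (fun _ => 0) (σ t), ?_, fun t ω => ?_, ?_⟩
  · refine measurable_uncurry_of_rightCts
      (fun t => Measurable.piecewise hNm measurable_const (hσ.measurable t)) fun ω t => ?_
    by_cases hω : ω ∈ N
    · simpa [piecewise, hω] using continuousWithinAt_const
    · simpa [piecewise, hω] using (hmem ω hω).2 t
  · by_cases hω : ω ∈ N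
    · simp [piecewise, hω]
    · simpa [piecewise, hω] using (hmem ω hω).1 t
  · filter_upwards [measure_eq_zero_iff_ae_notMem.1 hN0] with ω hω t
    simp [piecewise, hω]

/-- The Laplace transform of the potential measure is `1 / Φ`. -/
theorem IsPotentialDensity.lintegral_laplace [IsProbabilityMeasure P]
    (hσ : IsSubordinator σ P) (hσΦ : HasLaplaceExponent σ P Φ) (hu : IsPotentialDensity σ P u)
    {l : ℝ} (hl : 0 < l) (hΦ : 0 < Φ l) :
    ∫⁻ x, ENNReal.ofReal (Real.exp (-(l * x))) ∂(halfLineMeasure u) = ENNReal.ofReal (1 / Φ l) := by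
  obtain ⟨Y, hYm, hY0, hY⟩ := hσ.exists_version
  set T : Measure ℝ := volume.restrict (Ici 0)
  have hY' : Measurable fun p : Ω × ℝ => Y p.2.toNNReal p.1 :=
    hYm.comp (measurable_fst.prodMk (measurable_real_toNNReal.comp measurable_snd))
  -- The potential as a genuine measure, the image of `P × ds`; joint measurability of `Y` is what
  -- permits Tonelli.
  set π : Measure ℝ := (P.prod T).map fun p => Y p.2.toNNReal p.1
  have hπ (g : ℝ → ℝ≥0∞) (hg : Measurable g) :
      ∫⁻ x, g x ∂π = ∫⁻ ω, ∫⁻ s, g (Y s.toNNReal ω) ∂T ∂P := by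
    exact (lintegral_map hg hY').trans (lintegral_prod _ (hg.comp hY').aemeasurable)
  have hπσ (g : ℝ → ℝ≥0∞) (hg : Measurable g) :
      ∫⁻ x, g x ∂π = ∫⁻ ω, ∫⁻ s, g (σ s.toNNReal ω) ∂T ∂P := by
    rw [hπ g hg]
    refine lintegral_congr_ae ?_
    filter_upwards [hY] with ω hω
    simp only [hω]
  have hπ0 : π (Iio 0) = 0 := by
    rw [Measure.map_apply hY' measurableSet_Iio]
    convert measure_empty (μ := P.prod T)
    ext p
    simp [hY0]
  have hπu : π = halfLineMeasure u := by
    -- `hu.density` only speaks of subsets of `[0, ∞)`; the rest of `A` is null because `Y ≥ 0`.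
    refine Measure.ext fun A hA => ?_
    have h1 : π A = π (A ∩ Ici 0) := by
      refine (measure_inter_add_sdiff A (measurableSet_Ici (a := (0 : ℝ)))).symm.trans ?_
      rw [measure_mono_null (s := A \ Ici 0) (t := Iio 0) (fun x hx => by simpa using hx.2) hπ0, add_zero]
    have hA' : MeasurableSet (A ∩ Ici 0) := hA.inter measurableSet_Ici
    rw [h1, ← lintegral_indicator_one hA', hπσ _ (measurable_one.indicator hA')]
    refine (hu.density _ hA' inter_subset_right).trans ?_
    rw [halfLineMeasure, withDensity_apply _ hA, Measure.restrict_restrict hA]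
    congr 2
    ext x
    simp only [mem_inter_iff, mem_Ici, mem_Ioi]
    exact ⟨fun h => ⟨h.1.1, h.2⟩, fun h => ⟨⟨h.1, h.2.le⟩, h.2⟩⟩
  rw [← hπu, hπ _ (by fun_prop), lintegral_lintegral_swap
    (((hY'.const_mul l).neg.exp.ennreal_ofReal).aemeasurable)]
  have hexp (t : ℝ≥0) : ∫⁻ ω, ENNReal.ofReal (Real.exp (-(l * Y t ω))) ∂P =
      ENNReal.ofReal (Real.exp (-((t : ℝ) * Φ l))) := by
    have hI : Integrable (fun ω => Real.exp (-(l * σ t ω))) P := by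
      by_contra hcon
      have := hσΦ t l hl
      rw [integral_undef hcon] at this
      exact (Real.exp_pos _).ne this
    rw [← hσΦ t l hl, ofReal_integral_eq_lintegral_ofReal hI
      (Filter.Eventually.of_forall fun _ => Real.exp_nonneg _)]
    refine lintegral_congr_ae ?_
    filter_upwards [hY] with ω hω
    rw [hω]
  simp only [hexp]
  rw [← lintegral_exp_neg_mul_Ioi hΦ,
    show T = volume.restrict (Ioi 0) from restrict_Ioi_eq_restrict_Ici.symm]
  refine setLIntegral_congr_fun measurableSet_Ioi fun s hs => ?_
  rw [Real.coe_toNNReal _ (mem_Ioi.1 hs).le, mul_comm]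

end Potential

/-- The Sonine relation `u * ν̄ = 1`, as an identity between measures. -/
theorem IsPotentialDensity.conv_levyTail {Ω : Type*} [MeasurableSpace Ω] {P : Measure Ω}
    [IsProbabilityMeasure P] {σ : ℝ≥0 → Ω → ℝ} {u Φ : ℝ → ℝ} {ν : Measure ℝ}
    (hΦ : ∀ l : ℝ, 0 < l → 0 < Φ l) (hν : IsLevyTriple Φ 0 0 ν) (hσ : IsSubordinator σ P)
    (hσΦ : HasLaplaceExponent σ P Φ) (hu : IsPotentialDensity σ P u) :
    (halfLineMeasure u).conv (halfLineMeasure (levyTail ν)) = volume.restrict (Ioi 0) := by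
  have key (l : ℝ) (hl : 0 < l) :
      ∫⁻ x, ENNReal.ofReal (Real.exp (-(l * x)))
        ∂((halfLineMeasure u).conv (halfLineMeasure (levyTail ν))) = ENNReal.ofReal (1 / l) := by
    have hsplit (x y : ℝ) : ENNReal.ofReal (Real.exp (-(l * (x + y)))) =
        ENNReal.ofReal (Real.exp (-(l * x))) * ENNReal.ofReal (Real.exp (-(l * y))) := by
      rw [← ENNReal.ofReal_mul (Real.exp_nonneg _), ← Real.exp_add]
      congr 2; ring
    rw [Measure.lintegral_conv (by fun_prop)]
    simp only [hsplit]
    have hm : Measurable fun x : ℝ => ENNReal.ofReal (Real.exp (-(l * x))) := by fun_prop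
    simp only [lintegral_const_mul _ hm]
    rw [lintegral_mul_const _ hm, hu.lintegral_laplace hσ hσΦ hl (hΦ l hl),
      hν.lintegral_levyTail hl (hΦ l hl), ← ENNReal.ofReal_mul (one_div_pos.2 (hΦ l hl)).le]
    congr 1
    have := (hΦ l hl).ne'
    field_simp
  refine Measure.ext_of_laplace_eq (fun l hl => ?_) fun l hl => ?_
  · rw [key l hl]; exact ENNReal.ofReal_ne_top
  · rw [key l hl, lintegral_exp_neg_mul_Ioi hl]

/-! ### Convolution equations. -/

section Volterra

variable {X : Type*} [NormedAddCommGroup X] [NormedSpace ℝ X]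

/-- Translates between convolution with a measure and the interval integral used in `tailConv`. -/
theorem integral_halfLineMeasure_indicator {k : ℝ → ℝ} (hk : AntitoneOn k (Ioi 0))
    (hk0 : ∀ t, 0 < t → 0 ≤ k t) {t : ℝ} (ht : 0 ≤ t) (g : ℝ → X) :
    ∫ x, (Iic t).indicator g x ∂(halfLineMeasure k) = ∫ s in (0 : ℝ)..t, k (t - s) • g (t - s) := by
  rw [integral_halfLineMeasure hk hk0]
  have h (s : ℝ) : k s • (Iic t).indicator g s = (Iic t).indicator (fun s => k s • g s) s := by
    by_cases hs : s ∈ Iic t <;> simp [hs]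
  simp only [h]
  rw [setIntegral_indicator measurableSet_Iic, Ioi_inter_Iic,
    intervalIntegral.integral_comp_sub_left (fun s => k s • g s), sub_self, sub_zero,
    intervalIntegral.integral_of_le ht]

/-- If two measures on `(0, ∞)` convolve to Lebesgue measure there, then convolving a function
with both of them amounts to taking its primitive. -/
theorem integral_integral_of_conv_eq {μ κ : Measure ℝ} [SFinite μ] [SFinite κ]
    (h : μ.conv κ = volume.restrict (Ioi 0)) (hκ : κ (Iic 0) = 0) {w : ℝ → X} (hw : Continuous w)
    (t : ℝ) :
    ∫ x, (Iic t).indicator (fun x => ∫ y, (Iic (t - x)).indicator (fun y => w (t - x - y)) y ∂κ) x ∂μ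
      = ∫ x in Ioi 0, (Iic t).indicator (fun z => w (t - z)) x := by
  -- Integrability for Fubini comes from the convolution being Lebesgue measure, where the integrand
  -- is continuous on a bounded interval.
  have hI : Integrable ((Iic t).indicator fun z => w (t - z)) (μ.conv κ) := by
    rw [h, integrable_indicator_iff measurableSet_Iic, IntegrableOn,
      Measure.restrict_restrict measurableSet_Iic, inter_comm, Ioi_inter_Iic]
    exact (Continuous.integrableOn_Icc (by fun_prop)).mono_set Ioc_subset_Icc_self
  have ha : Measurable fun p : ℝ × ℝ => p.1 + p.2 := by fun_prop
  rw [← h]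
  rw [Measure.conv] at hI ⊢
  rw [integral_map ha.aemeasurable hI.aestronglyMeasurable]
  refine Eq.trans ?_ (integral_prod _
    ((integrable_map_measure hI.aestronglyMeasurable ha.aemeasurable).1 hI)).symm
  refine integral_congr_ae (Filter.Eventually.of_forall fun x => ?_)
  have hκ' : ∀ᵐ y ∂κ, 0 < y := by
    filter_upwards [measure_eq_zero_iff_ae_notMem.1 hκ] with y hy using not_le.1 hy
  by_cases hx : x ∈ Iic t
  · simp only [indicator_of_mem hx]
    refine integral_congr_ae (Filter.Eventually.of_forall fun y => ?_)
    simp only [Function.comp_apply, indicator, mem_Iic, le_sub_iff_add_le, add_comm y x, sub_sub]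
  -- For `x > t` the inner integral vanishes too, because `κ` only charges `y > 0`.
  · simp only [indicator_of_notMem hx]
    symm
    refine integral_eq_zero_of_ae ?_
    filter_upwards [hκ'] with y hy
    refine indicator_of_notMem (fun hxy => hx ?_) _
    simp only [mem_Iic] at hxy ⊢
    linarith

open Filter Topology in
/-- The Laplace transform of a measure on `(0, ∞)` tends to `0` at infinity. -/
theorem tendsto_lintegral_exp_neg_mul {μ : Measure ℝ} (hμ : μ (Iic 0) = 0)
    (hfin : ∫⁻ x, ENNReal.ofReal (Real.exp (-(1 * x))) ∂μ ≠ ∞) :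
    Tendsto (fun l : ℝ => ∫⁻ x, ENNReal.ofReal (Real.exp (-(l * x))) ∂μ) atTop (𝓝 0) := by
  have hμ' : ∀ᵐ y ∂μ, 0 < y := by
    filter_upwards [measure_eq_zero_iff_ae_notMem.1 hμ] with y hy using not_le.1 hy
  have := tendsto_lintegral_filter_of_dominated_convergence (μ := μ) (l := atTop)
    (F := fun l x : ℝ => ENNReal.ofReal (Real.exp (-(l * x)))) (f := fun _ => 0)
    (fun x => ENNReal.ofReal (Real.exp (-(1 * x)))) (Eventually.of_forall fun l => by fun_prop)
    ?_ hfin ?_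
  · simpa using this
  · filter_upwards [eventually_ge_atTop 1] with l hl
    filter_upwards [hμ'] with x hx
    gcongr
  · filter_upwards [hμ'] with x hx
    rw [← ENNReal.ofReal_zero]
    refine ENNReal.tendsto_ofReal (Real.tendsto_exp_neg_atTop_nhds_zero.comp ?_)
    exact tendsto_id.atTop_mul_const hx

/-- Gronwall's lemma for convolution inequalities. -/
theorem eq_zero_of_norm_le_conv {μ : Measure ℝ} (hμ : μ (Iic 0) = 0)
    (hfin : ∀ l : ℝ, 0 < l → ∫⁻ x, ENNReal.ofReal (Real.exp (-(l * x))) ∂μ ≠ ∞)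
    {W : ℝ → X} (hW : Continuous W) (F : X →L[ℝ] X)
    (h : ∀ t, 0 ≤ t → W t = ∫ x, (Iic t).indicator (fun x => F (W (t - x))) x ∂μ) {t : ℝ}
    (ht : 0 ≤ t) : W t = 0 := by
  have hμ' : ∀ᵐ y ∂μ, 0 < y := by
    filter_upwards [measure_eq_zero_iff_ae_notMem.1 hμ] with y hy using not_le.1 hy
  -- This makes the contraction constant at most `‖F‖ / (‖F‖ + 1) < 1`; the `+ 1` also covers `F =
  -- 0`.
  obtain ⟨l, hl0, hl⟩ : ∃ l : ℝ, 0 < l ∧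
      ∫⁻ x, ENNReal.ofReal (Real.exp (-(l * x))) ∂μ < ENNReal.ofReal (1 / (‖F‖ + 1)) :=
    ((Filter.eventually_gt_atTop 0).and ((tendsto_lintegral_exp_neg_mul hμ
      (hfin 1 one_pos)).eventually_lt_const (ENNReal.ofReal_pos.2 (by positivity)))).exists
  have hI : Integrable (fun x => Real.exp (-(l * x))) μ := by
    refine ⟨by fun_prop, ?_⟩
    rw [hasFiniteIntegral_iff_ofReal (Filter.Eventually.of_forall fun x => Real.exp_nonneg _)]
    exact (hfin l hl0).lt_top
  have hint : ∫ x, Real.exp (-(l * x)) ∂μ < 1 / (‖F‖ + 1) := by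
    rw [← ofReal_integral_eq_lintegral_ofReal hI
      (Filter.Eventually.of_forall fun _ => Real.exp_nonneg _)] at hl
    exact (ENNReal.ofReal_lt_ofReal_iff (by positivity)).1 hl
  obtain ⟨r, hr, hmax⟩ := isCompact_Icc.exists_isMaxOn (nonempty_Icc.2 ht)
    (f := fun s => Real.exp (-(l * s)) * ‖W s‖) (by fun_prop)
  set M := Real.exp (-(l * r)) * ‖W r‖ with hM
  have hM0 : 0 ≤ M := by positivity
  -- Splitting `e^{-l r} = e^{-l x} e^{-l (r - x)}` lets the maximum `M` bound the factor at `r -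
  -- x`.
  have hle : M ≤ ∫ x, Real.exp (-(l * x)) * (‖F‖ * M) ∂μ := by
    have heq : M = ‖∫ x, Real.exp (-(l * r)) • (Iic r).indicator (fun x => F (W (r - x))) x ∂μ‖ := by
      rw [integral_smul, norm_smul, Real.norm_of_nonneg (Real.exp_nonneg _), ← h r hr.1]
    refine heq.le.trans (norm_integral_le_of_norm_le (hI.mul_const _) ?_)
    filter_upwards [hμ'] with x hx
    by_cases hxr : x ∈ Iic r
    · have hm := hmax (show r - x ∈ Icc 0 t from
        ⟨sub_nonneg.2 hxr, by linarith [hr.2]⟩)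
      simp only [mem_ofPred_eq] at hm
      rw [indicator_of_mem hxr, norm_smul, Real.norm_of_nonneg (Real.exp_nonneg _),
        show -(l * r) = -(l * x) + -(l * (r - x)) by ring, Real.exp_add, mul_assoc]
      refine mul_le_mul_of_nonneg_left ?_ (Real.exp_nonneg _)
      calc _ ≤ Real.exp (-(l * (r - x))) * (‖F‖ * ‖W (r - x)‖) := by
            gcongr; exact F.le_opNorm _
        _ = ‖F‖ * (Real.exp (-(l * (r - x))) * ‖W (r - x)‖) := by ring
        _ ≤ ‖F‖ * M := mul_le_mul_of_nonneg_left hm (norm_nonneg _)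
    · rw [indicator_of_notMem hxr]
      simpa using by positivity
  rw [integral_mul_const] at hle
  have hM' : M = 0 := by
    by_contra hne
    have hMpos : 0 < M := lt_of_le_of_ne hM0 (Ne.symm hne)
    have h1 : (∫ x, Real.exp (-(l * x)) ∂μ) * (‖F‖ * M) ≤ 1 / (‖F‖ + 1) * (‖F‖ * M) := by
      gcongr
    have h2 : 1 / (‖F‖ + 1) * (‖F‖ * M) < M := by
      rw [one_div_mul_eq_div, div_lt_iff₀ (by positivity)]
      nlinarith
    linarith
  have hm := hmax (show t ∈ Icc 0 t from ⟨ht, le_rfl⟩)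
  simp only [mem_ofPred_eq] at hm
  rw [← hM, hM'] at hm
  have := norm_nonneg (W t)
  have := Real.exp_pos (-(l * t))
  exact norm_le_zero_iff.1 (by nlinarith)

end Volterra

/-! ### Integrating the Caputo equation. -/

section Equation

variable {X : Type*} [NormedAddCommGroup X] [NormedSpace ℝ X]

/-- The fundamental theorem of calculus for an absolutely continuous function with a continuous
derivative. -/
theorem AbsolutelyContinuousOnInterval.sub_eq_integral [CompleteSpace X] {J h : ℝ → X} {T : ℝ}
    (hT : 0 ≤ T) (hJ : AbsolutelyContinuousOnInterval J 0 T) (hh : Continuous h)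
    (hd : ∀ᵐ t : ℝ, 0 < t → HasDerivAt J (h t) t) : J T - J 0 = ∫ s in (0 : ℝ)..T, h s := by
  have hH (t : ℝ) : HasDerivAt (fun t => ∫ s in (0 : ℝ)..t, h s) (h t) t :=
    intervalIntegral.integral_hasDerivAt_right (hh.intervalIntegrable _ _)
      hh.aestronglyMeasurable.stronglyMeasurableAtFilter hh.continuousAt
  have hHac : AbsolutelyContinuousOnInterval (fun t => ∫ s in (0 : ℝ)..t, h s) 0 T := by
    refine ContDiffOn.absolutelyContinuousOnInterval (ContDiff.contDiffOn ?_)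
    refine contDiff_one_iff_deriv.2 ⟨fun t => (hH t).differentiableAt, ?_⟩
    rwa [show deriv (fun t => ∫ s in (0 : ℝ)..t, h s) = h from funext fun t => (hH t).deriv]
  -- An absolutely continuous function with a.e. zero derivative is constant; the point `0`, where
  -- `hd` is silent, is null.
  obtain ⟨C, hC⟩ := (hJ.sub hHac).const_of_ae_hasDerivAt_zero (by
    have h0 : ∀ᵐ t : ℝ, t ≠ 0 := measure_eq_zero_iff_ae_notMem.1 (measure_singleton (0 : ℝ))
    filter_upwards [hd, h0] with t ht ht0 hmem
    rw [uIcc_of_le hT] at hmem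
    simpa using (ht (lt_of_le_of_ne hmem.1 (Ne.symm ht0))).sub (hH t))
  have h1 := hC 0 left_mem_uIcc
  have h2 := hC T right_mem_uIcc
  simp only [Pi.sub_apply, intervalIntegral.integral_same, sub_zero] at h1 h2
  rw [h1, ← h2]
  abel

/-- The convolution of a tail of a Lévy measure with a continuous function is well defined. -/
theorem IsLevyTriple.intervalIntegrable_levyTail_smul {Φ : ℝ → ℝ} {ν : Measure ℝ}
    (hν : IsLevyTriple Φ 0 0 ν) (hΦ : 0 < Φ 1) {f : ℝ → X} (hf : ContinuousOn f (Ici 0)) {t : ℝ}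
    (ht : 0 ≤ t) : IntervalIntegrable (fun s => levyTail ν (t - s) • f s) volume 0 t := by
  have hm : AEMeasurable (levyTail ν) (volume.restrict (Ioi 0)) :=
    aemeasurable_restrict_of_antitoneOn measurableSet_Ioi hν.antitoneOn_levyTail
  -- Finiteness of the Laplace transform at `1` gives integrability with weight `e^{-s}`; on `[0,
  -- t]` the weight is then divided out.
  have hI : IntegrableOn (fun s => Real.exp (-(1 * s)) * levyTail ν s) (Ioi 0) := by
    refine ⟨(AEMeasurable.mul (by fun_prop) hm).aestronglyMeasurable, ?_⟩
    have hnn (s : ℝ) : 0 ≤ Real.exp (-(1 * s)) * levyTail ν s :=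
      mul_nonneg (Real.exp_nonneg _) measureReal_nonneg
    rw [hasFiniteIntegral_iff_ofReal (Filter.Eventually.of_forall hnn)]
    have h := hν.lintegral_levyTail one_pos hΦ
    rw [lintegral_halfLineMeasure hν.antitoneOn_levyTail (by fun_prop)] at h
    simp only [ENNReal.ofReal_mul (Real.exp_nonneg _), mul_comm (ENNReal.ofReal (Real.exp _)), h]
    exact ENNReal.ofReal_lt_top
  have hI1 : IntervalIntegrable (levyTail ν) volume 0 t := by
    have := (intervalIntegrable_iff_integrableOn_Ioc_of_le ht).2 (hI.mono_set Ioc_subset_Ioi_self)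
    refine (this.continuousOn_mul (g := fun s => Real.exp (1 * s)) (by fun_prop)).congr
      (fun s _ => ?_)
    rw [← mul_assoc, ← Real.exp_add, add_neg_cancel, Real.exp_zero, one_mul]
  have hI2 : IntervalIntegrable (fun s => levyTail ν (t - s)) volume 0 t := by
    simpa using (hI1.comp_sub_left t).symm
  refine hI2.smul_continuousOn (hf.mono ?_)
  rw [uIcc_of_le ht]
  exact Icc_subset_Ici_self

end Equation

/-! ### Uniqueness of global solutions. -/

theorem corollary3p3 {X : Type*} [NormedAddCommGroup X] [NormedSpace ℝ X] [CompleteSpace X]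
    {Ω : Type*} [MeasurableSpace Ω] (P : Measure Ω) [IsProbabilityMeasure P]
    (Φ : ℝ → ℝ) (ν : Measure ℝ) (σ : ℝ≥0 → Ω → ℝ) (u : ℝ → ℝ)
    (hΦ : IsSpecialBernstein Φ) (hν : IsLevyTriple Φ 0 0 ν) (hν_inf : ν (Ioi 0) = ∞)
    (hσ : IsSubordinator σ P) (hσΦ : HasLaplaceExponent σ P Φ) (hu : IsPotentialDensity σ P u)
    (hu_bound : ∃ t₀ : ℝ, 0 < t₀ ∧ ∃ C : ℝ, 0 < C ∧ ∃ β ∈ Ioo (0 : ℝ) 1,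
      ∀ t ∈ Ioo 0 t₀, u t ≤ C * t ^ (β - 1))
    (hν_ac : ν ≪ volume)
    (F : X →L[ℝ] X) (ξ f₀ : X) (f₁ f₂ : ℝ → X)
    (hf₁ : IsGlobalSolution ν F ξ f₀ f₁) (hf₂ : IsGlobalSolution ν F ξ f₀ f₂) :
    EqOn f₁ f₂ (Ici 0) := by
  -- Freezing the value at `0` for negative times makes the difference continuous on all of `ℝ`.
  set w : ℝ → X := fun s => f₁ (max s 0) - f₂ (max s 0)
  have hmax : Continuous fun s : ℝ => max s 0 := by fun_prop
  have hw : Continuous w :=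
    (hf₁.cont.comp_continuous hmax fun s => le_max_right s 0).sub
      (hf₂.cont.comp_continuous hmax fun s => le_max_right s 0)
  have hw_eq (s : ℝ) (hs : 0 ≤ s) : w s = f₁ s - f₂ s := by simp [w, max_eq_left hs]
  set W : ℝ → X := fun t => ∫ s in (0 : ℝ)..t, w s
  have hWd (t : ℝ) : HasDerivAt W (w t) t :=
    intervalIntegral.integral_hasDerivAt_right (hw.intervalIntegrable _ _)
      hw.aestronglyMeasurable.stronglyMeasurableAtFilter hw.continuousAt
  have hWc : Continuous W := continuous_iff_continuousAt.2 fun t => (hWd t).continuousAt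
  -- the integrated equation for the difference
  have hconv (t : ℝ) (ht : 0 ≤ t) :
      ∫ s in (0 : ℝ)..t, levyTail ν (t - s) • w s = F (W t) := by
    have hJ (r : ℝ) (hr : 0 ≤ r) : (tailConv ν f₁ - tailConv ν f₂) r =
        ∫ s in (0 : ℝ)..r, levyTail ν (r - s) • w s := by
      simp only [Pi.sub_apply, tailConv]
      rw [← intervalIntegral.integral_sub
        (hν.intervalIntegrable_levyTail_smul (hΦ.pos 1 one_pos)
          (f := fun s => f₁ s - f₁ 0) (hf₁.cont.sub continuousOn_const) hr)
        (hν.intervalIntegrable_levyTail_smul (hΦ.pos 1 one_pos)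
          (f := fun s => f₂ s - f₂ 0) (hf₂.cont.sub continuousOn_const) hr)]
      refine intervalIntegral.integral_congr fun s hs => ?_
      rw [uIcc_of_le hr] at hs
      rw [hw_eq s hs.1, hf₁.init, hf₂.init, ← smul_sub, sub_sub_sub_cancel_right]
    have hJ0 : (tailConv ν f₁ - tailConv ν f₂) 0 = 0 := by simp [tailConv]
    rcases ht.eq_or_lt with rfl | htpos
    · simp [W]
    have hac := (hf₁.equation.absCont t htpos).sub (hf₂.equation.absCont t htpos)
    have := hac.sub_eq_integral ht (F.continuous.comp hw) (by
      filter_upwards [hf₁.equation.deriv_eq, hf₂.equation.deriv_eq] with s h1 h2 hs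
      refine ((h1 hs).sub (h2 hs)).congr_deriv ?_
      simp [hw_eq s hs.le])
    rw [hJ0, sub_zero, hJ t ht] at this
    rw [this]
    exact F.intervalIntegral_comp_comm (hw.intervalIntegrable _ _)
  -- convolving with the potential density
  have hvol := hu.conv_levyTail hΦ.pos hν hσ hσΦ
  have hfix (t : ℝ) (ht : 0 ≤ t) :
      W t = ∫ x, (Iic t).indicator (fun x => F (W (t - x))) x ∂(halfLineMeasure u) := by
    have h1 := integral_integral_of_conv_eq hvol (halfLineMeasure_Iic _) hw t
    have h2 : ∫ x in Ioi 0, (Iic t).indicator (fun z => w (t - z)) x = W t := by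
      rw [setIntegral_indicator measurableSet_Iic, Ioi_inter_Iic,
        ← intervalIntegral.integral_of_le ht, intervalIntegral.integral_comp_sub_left, sub_self,
        sub_zero]
    rw [← h2, ← h1]
    refine integral_congr_ae (Filter.Eventually.of_forall fun x => ?_)
    by_cases hx : x ∈ Iic t
    · simp only [indicator_of_mem hx]
      rw [integral_halfLineMeasure_indicator hν.antitoneOn_levyTail
        (fun s _ => measureReal_nonneg) (sub_nonneg.2 hx), ← hconv _ (sub_nonneg.2 hx)]
      simp only [sub_sub_cancel]
    · simp only [indicator_of_notMem hx]
  have hfin (l : ℝ) (hl : 0 < l) :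
      ∫⁻ x, ENNReal.ofReal (Real.exp (-(l * x))) ∂(halfLineMeasure u) ≠ ∞ := by
    rw [hu.lintegral_laplace hσ hσΦ hl (hΦ.pos l hl)]
    exact ENNReal.ofReal_ne_top
  have hW0 (t : ℝ) (ht : 0 ≤ t) : W t = 0 :=
    eq_zero_of_norm_le_conv (halfLineMeasure_Iic u) hfin hWc F hfix ht
  intro t ht
  -- `W` vanishes only on `[0, ∞)`, so a one-sided derivative is used; this includes `t = 0`.
  have hd : HasDerivWithinAt W 0 (Ici t) t :=
    (hasDerivWithinAt_const t (Ici t) (0 : X)).congr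
      (fun s hs => hW0 s (le_trans ht hs)) (hW0 t ht)
  have hwt : w t = 0 := (uniqueDiffOn_Ici t t self_mem_Ici).eq_deriv _ (hWd t).hasDerivWithinAt hd
  rw [hw_eq t ht] at hwt
  exact sub_eq_zero.1 hwt
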